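/- **The multivariate system of Hoffmann et al. (2011).** Data types are $A ::= \mathsf{unit}\mid\mathsf{bool}\mid\mathsf{int}\mid A_1\times A_2\mid L(A)\mid T(A)$. The set $\llbracket A\rrbracket$ consists of the semantic values of $A$: $\llbracket\mathsf{unit}\rrbracket$ is a one-point set, $\llbracket\mathsf{bool}\rrbracket$ the booleans, $\llbracket\mathsf{int}\rrbracket=\mathbb Z$, $\llbracket A_1\times A_2\rrbracket=\llbracket A_1\rrbracket\times\llbracket A_2\rrbracket$, $\llbracket L(A)\rrbracket$ the finite lists and $\llbracket T(A)\rrbracket$ the finite binary trees with node labels in $\llbracket A\rrbracket$. Indices and their base polynomials $p_i:\llbracket A\rrbracket\to\mathbb N$ are: the single index $\star$ with $p_\star=1$ for $\mathsf{unit},\mathsf{bool},\mathsf{int}$; pairs $(i_1,i_2)$ with $p_{(i_1,i_2)}(a_1,a_2)=p_{i_1}(a_1)\,p_{i_2}(a_2)$ for products; and finite sequences $[i_1,\dots,i_k]$ $(k\ge 0)$ of indices of $A$ for both $L(A)$ and $T(A)$, with $$p_{[i_1,\dots,i_k]}([a_1,\dots,a_n])=\sum_{1\le j_1<\dots<j_k\le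 n}\ \prod_{m=1}^k p_{i_m}(a_{j_m}),$$ where a tree is evaluated through the list $[a_1,\dots,a_n]$ of its labels in preorder. A *resource polynomial* for $A$ is a linear combination of base polynomials with coefficients in $\mathbb Q_{\ge0}$. **The new system.** Types are $\tau ::= \alpha\mid\mathbf 1\mid\tau_1\times\tau_2\mid\tau_1+\tau_2\mid\langle\tau_1\to\tau_2,\Theta,\Theta_{\mathsf{cf}}\rangle\mid\mu\alpha.\tau$ (with sets $\Theta,\Theta_{\mathsf{cf}}$ of resource specifications, that is, pairs of annotations, which play no role below). Values are $v::=\mathsf{tt}\mid\mathsf{pair}(v_1;v_2)\mid\mathsf{inl}\,v\mid\mathsf{inr}\,v\mid\mathsf{fun}(f,x.e)\mid\mathsf{fold}\,v$, and $\mathcal V(\tau)$ is the set of values of type $\tau$, where $\mathsf{fold}\,v\in\mathcal V(\mu\alpha.\tau)$ iff $v\in\mathcal V([\mu\alpha.\tau/\alpha]\tau)$, and every $\mathsf{fun}(f,x.e)$ belongs to $\mathcal V$ of every arrow type. The set $\mathcal I(\tau)$ of indices mirrors $\mathcal V(\tau)$, with a single index $\lambda$ for each arrow type and an additional index $\mathsf{end}\in\mathcal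 I(\mu\alpha.\tau)$. The constant index sets are - $\mathcal C(\mathbf 1)=\{\mathsf{tt}\}$, - $\mathcal C(\tau_1\times\tau_2)=\{\mathsf{pair}(c_1;c_2)\mid c_1\in\mathcal C(\tau_1),\ c_2\in\mathcal C(\tau_2)\}$, - $\mathcal C(\tau_1+\tau_2)=\mathsf{inl}\,\mathcal C(\tau_1)\cup\mathsf{inr}\,\mathcal C(\tau_2)$, - $\mathcal C(\langle\tau_1\to\tau_2,\Theta,\Theta_{\mathsf{cf}}\rangle)=\{\lambda\}$, - $\mathcal C(\mu\alpha.\tau)=\mathcal C(\alpha)=\mathcal C(\top_\mu)=\{\mathsf{end}\}$, where $\top_\mu$ is an auxiliary symbol. The recursive occurrence indices are - $\mathcal M\{\alpha.\alpha\}(i)=\{i\}$, - $\mathcal M\{\alpha.\tau\}(i)=\emptyset$ if $\tau$ is $\mathbf 1$, $\top_\mu$ or an arrow type, - $\mathcal M\{\alpha.\tau_1+\tau_2\}(i)=\mathsf{inl}\,\mathcal M\{\alpha.\tau_1\}(i)\cup\mathsf{inr}\,\mathcal M\{\alpha.\tau_2\}(i)$, - $\mathcal M\{\alpha.\tau_1\times\tau_2\}(i)=\mathsf{pair}(\mathcal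 M\{\alpha.\tau_1\}(i);\mathcal C(\tau_2))\cup\mathsf{pair}(\mathcal C(\tau_1);\mathcal M\{\alpha.\tau_2\}(i))$, - $\mathcal M\{\alpha.\mu\beta.\tau\}(i)=\mathsf{fold}\,\mathcal M\{\alpha.[\top_\mu/\beta]\tau\}(i)$. Base polynomials $\phi_i(v:\tau)\in\mathbb N$, for $i\in\mathcal I(\tau)$ and $v\in\mathcal V(\tau)$, are $1$ for $\mathsf{tt}$ on $\mathsf{tt}$, for $\lambda$ on functions and for $\mathsf{end}$; multiplicative on pairs; $\phi_{\mathsf{inl}\,i}(\mathsf{inl}\,v:\tau_1+\tau_2)=\phi_i(v:\tau_1)$ and $\phi_{\mathsf{inr}\,i}(\mathsf{inr}\,v:\tau_1+\tau_2)=\phi_i(v:\tau_2)$; $0$ on mismatched injections; and, with $\sigma=[\mu\alpha.\tau/\alpha]\tau$, $$\phi_{\mathsf{fold}\,i}(\mathsf{fold}\,v:\mu\alpha.\tau)=\phi_i(v:\sigma)+\sum_{k\in\mathcal M\{\alpha.\tau\}(\mathsf{fold}\,i)}\phi_k(v:\sigma).$$ An *annotation* $P\in\mathcal A(\tau)$ is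 a finitely supported family $(p_i)_{i\in\mathcal I(\tau)}$ in $\mathbb Q_{\ge0}$, and $\Phi(v:\langle\tau;P\rangle)=\sum_i p_i\,\phi_i(v:\tau)$. **Translation.** Let $\iota$ be any closed type and $e:\mathbb Z\to\mathcal V(\iota)$ any map, chosen to represent integers. Each $A$ is read as a type $A^\circ$ and each $a\in\llbracket A\rrbracket$ as a value $a^\circ\in\mathcal V(A^\circ)$ in the standard way: $\mathsf{unit}^\circ=\mathbf 1$, $\mathsf{bool}^\circ=\mathbf 1+\mathbf 1$ (true is $\mathsf{inl}\,\mathsf{tt}$, false is $\mathsf{inr}\,\mathsf{tt}$), $\mathsf{int}^\circ=\iota$ (with $n^\circ=e(n)$), $(A_1\times A_2)^\circ=A_1^\circ\times A_2^\circ$, $L(A)^\circ=\mu\alpha.\,\mathbf 1+A^\circ\times\alpha$ and $T(A)^\circ=\mu\alpha.\,\mathbf 1+A^\circ\times(\alpha\times\alpha)$ (a node with label $a$, left subtree $l$ and right subtree $r$ is $\mathsf{fold}(\mathsf{inr}\,\mathsf{pair}(a^\circ;\mathsf{pair}(l^\circ;r^\circ)))$). **Theorem.** For every data type $A$ of the multivariate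 system and every resource polynomial $p:\llbracket A\rrbracket\to\mathbb Q_{\ge0}$ for $A$, there is an annotation $P\in\mathcal A(A^\circ)$ such that $\Phi(a^\circ:\langle A^\circ;P\rangle)=p(a)$ for all $a\in\llbracket A\rrbracket$. -/

import Mathlib

open scoped NNRat

noncomputable section

namespace AARA

/-! ## The new system: types, values, indices, resource polynomials -/

/-- Base polynomial indices, as raw syntax: `tt`, `pair (i; j)`, `inl i`, `inr i`, the index `lam` of
function types, `fold i`, and the index `recEnd` (the index `end`) of recursive types. -/
inductive Idx : Type
  | tt
  | pair (i j : Idx)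
  | inl (i : Idx)
  | inr (i : Idx)
  | lam
  | fold (i : Idx)
  | recEnd
  deriving DecidableEq

/-- Types. Type variables are de Bruijn indices, and `mu τ` binds the variable `0` of `τ`.
The arrow type carries its two sets of resource specifications (pairs of annotations, here finitely
supported functions on raw indices). `topMu` is the auxiliary symbol `⊤_μ` that replaces the bound
variable of a nested recursive type in the definition of `occ`; it does not occur in proper types
(see `Ty.Closed`). -/
inductive Ty : Type
  | var (n : ℕ)
  | one
  | prod (τ₁ τ₂ : Ty)
  | sum (τ₁ τ₂ : Ty)
  | arrow (τ₁ τ₂ : Ty) (Θ Θcf : Set ((Idx →₀ ℚ≥0) × (Idx →₀ ℚ≥0)))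
  | mu (τ : Ty)
  | topMu

namespace Ty

/-- Action of a renaming under a binder. -/
def liftRen (f : ℕ → ℕ) : ℕ → ℕ
  | 0 => 0
  | n + 1 => f n + 1

/-- Renaming of the free type variables. -/
def rename : (ℕ → ℕ) → Ty → Ty
  | f, var n => var (f n)
  | _, one => one
  | f, prod τ₁ τ₂ => prod (rename f τ₁) (rename f τ₂)
  | f, sum τ₁ τ₂ => sum (rename f τ₁) (rename f τ₂)
  | f, arrow τ₁ τ₂ Θ Θcf => arrow (rename f τ₁) (rename f τ₂) Θ Θcf
  | f, mu τ => mu (rename (liftRen f) τ)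
  | _, topMu => topMu

/-- Weakening: the type `τ`, viewed under one more binder. -/
def weaken (τ : Ty) : Ty := rename Nat.succ τ

/-- Action of a substitution under a binder. -/
def liftSub (s : ℕ → Ty) : ℕ → Ty
  | 0 => var 0
  | n + 1 => weaken (s n)

/-- Simultaneous capture-avoiding substitution. -/
def subst : (ℕ → Ty) → Ty → Ty
  | s, var n => s n
  | _, one => one
  | s, prod τ₁ τ₂ => prod (subst s τ₁) (subst s τ₂)
  | s, sum τ₁ τ₂ => sum (subst s τ₁) (subst s τ₂)
  | s, arrow τ₁ τ₂ Θ Θcf => arrow (subst s τ₁) (subst s τ₂) Θ Θcf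
  | s, mu τ => mu (subst (liftSub s) τ)
  | _, topMu => topMu

/-- The substitution that sends the variable `0` to `σ` and lowers the other variables by one. -/
def single (σ : Ty) : ℕ → Ty
  | 0 => σ
  | n + 1 => var n

/-- `inst τ σ` is `[σ/α]τ`, where `α` is the variable `0` of `τ`. -/
def inst (τ σ : Ty) : Ty := subst (single σ) τ

/-- `unfold τ` is `[μα.τ/α]τ`, the unfolding of the recursive type `μα.τ`. -/
def unfold (τ : Ty) : Ty := inst τ (mu τ)

/-- All free variables of the type are `< k`, and `topMu` does not occur in it. -/
def ClosedAt : ℕ → Ty → Prop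
  | k, var n => n < k
  | _, one => True
  | k, prod τ₁ τ₂ => ClosedAt k τ₁ ∧ ClosedAt k τ₂
  | k, sum τ₁ τ₂ => ClosedAt k τ₁ ∧ ClosedAt k τ₂
  | k, arrow τ₁ τ₂ _ _ => ClosedAt k τ₁ ∧ ClosedAt k τ₂
  | k, mu τ => ClosedAt (k + 1) τ
  | _, topMu => False

/-- Proper closed types. -/
def Closed (τ : Ty) : Prop := ClosedAt 0 τ

/-- The number of syntax nodes. -/
def size : Ty → ℕ
  | var _ => 1
  | one => 1
  | prod τ₁ τ₂ => size τ₁ + size τ₂ + 1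
  | sum τ₁ τ₂ => size τ₁ + size τ₂ + 1
  | arrow τ₁ τ₂ _ _ => size τ₁ + size τ₂ + 1
  | mu τ => size τ + 1
  | topMu => 1

theorem size_rename (f : ℕ → ℕ) (τ : Ty) : size (rename f τ) = size τ := by
  induction τ generalizing f <;> simp_all [rename, size]

theorem size_subst (τ : Ty) (s : ℕ → Ty) (hs : ∀ n, size (s n) = 1) :
    size (subst s τ) = size τ := by
  induction τ generalizing s with
  | mu τ ih =>
    have h : ∀ n, size (liftSub s n) = 1 := by
      intro n
      cases n with
      | zero => rfl
      | succ n => simp [liftSub, weaken, size_rename, hs]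
    simp [subst, size, ih _ h]
  | _ => simp_all [subst, size]

theorem size_inst_topMu (τ : Ty) : size (inst τ topMu) = size τ :=
  size_subst τ _ fun n => by cases n <;> rfl

theorem liftSub_comp (s : ℕ → Ty) (f : ℕ → ℕ) :
    (fun n => liftSub s (liftRen f n)) = liftSub (fun n => s (f n)) := by
  funext n
  cases n <;> rfl

theorem subst_rename (τ : Ty) (f : ℕ → ℕ) (s : ℕ → Ty) :
    subst s (rename f τ) = subst (fun n => s (f n)) τ := by
  induction τ generalizing f s with
  | mu τ ih => simp [subst, rename, ih, liftSub_comp]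
  | _ => simp_all [subst, rename]

theorem subst_var (τ : Ty) : subst var τ = τ := by
  have h : liftSub var = var := by
    funext n
    cases n <;> rfl
  induction τ <;> simp_all [subst]

theorem inst_weaken (τ σ : Ty) : inst (weaken τ) σ = τ :=
  (subst_rename τ _ _).trans (subst_var τ)

end Ty

/-- Expressions of the language, with de Bruijn indices for the variables: `fn e` is `fun(f, x. e)`
and binds two variables in `e`. They occur only in the bodies of function values. -/
inductive Exp : Type
  | var (n : ℕ)
  | tt
  | pair (e₁ e₂ : Exp)
  | casep (e e' : Exp)
  | inl (e : Exp)
  | inr (e : Exp)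
  | cases (e eₗ eᵣ : Exp)
  | fn (e : Exp)
  | app (e₁ e₂ : Exp)
  | fold (e : Exp)
  | unfold (e : Exp)
  | tick (q : ℚ)
  | letin (e₁ e₂ : Exp)

/-- Values, as raw syntax. -/
inductive Val : Type
  | tt
  | pair (v₁ v₂ : Val)
  | inl (v : Val)
  | inr (v : Val)
  | fn (e : Exp)
  | fold (v : Val)

/-- The judgement `v ∈ 𝒱(τ)`. -/
inductive HasVal : Ty → Val → Prop
  | tt : HasVal .one .tt
  | fn {τ₁ τ₂ : Ty} {Θ Θcf : Set ((Idx →₀ ℚ≥0) × (Idx →₀ ℚ≥0))} {e : Exp} :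
      HasVal (.arrow τ₁ τ₂ Θ Θcf) (.fn e)
  | pair {τ₁ τ₂ : Ty} {v₁ v₂ : Val} : HasVal τ₁ v₁ → HasVal τ₂ v₂ →
      HasVal (.prod τ₁ τ₂) (.pair v₁ v₂)
  | inl {τ₁ τ₂ : Ty} {v : Val} : HasVal τ₁ v → HasVal (.sum τ₁ τ₂) (.inl v)
  | inr {τ₁ τ₂ : Ty} {v : Val} : HasVal τ₂ v → HasVal (.sum τ₁ τ₂) (.inr v)
  | fold {τ : Ty} {v : Val} : HasVal τ.unfold v → HasVal (.mu τ) (.fold v)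

/-- The judgement `i ∈ ℐ(τ)`. -/
inductive HasIdx : Ty → Idx → Prop
  | tt : HasIdx .one .tt
  | pair {τ₁ τ₂ : Ty} {i₁ i₂ : Idx} : HasIdx τ₁ i₁ → HasIdx τ₂ i₂ →
      HasIdx (.prod τ₁ τ₂) (.pair i₁ i₂)
  | inl {τ₁ τ₂ : Ty} {i : Idx} : HasIdx τ₁ i → HasIdx (.sum τ₁ τ₂) (.inl i)
  | inr {τ₁ τ₂ : Ty} {i : Idx} : HasIdx τ₂ i → HasIdx (.sum τ₁ τ₂) (.inr i)
  | lam {τ₁ τ₂ : Ty} {Θ Θcf : Set ((Idx →₀ ℚ≥0) × (Idx →₀ ℚ≥0))} :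
      HasIdx (.arrow τ₁ τ₂ Θ Θcf) .lam
  | fold {τ : Ty} {i : Idx} : HasIdx τ.unfold i → HasIdx (.mu τ) (.fold i)
  | recEnd {τ : Ty} : HasIdx (.mu τ) .recEnd

/-- The type `𝒱(τ)` of values of type `τ`. -/
abbrev Values (τ : Ty) : Type := {v : Val // HasVal τ v}

/-- The type `ℐ(τ)` of indices of type `τ`. -/
abbrev Indices (τ : Ty) : Type := {i : Idx // HasIdx τ i}

/-- The constant index set `𝒞(τ)`. A type variable met here is the bound variable of a recursive
type and stands for that recursive type, so its constant index set is `{end}`. -/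
def constIdx : Ty → Finset Idx
  | .var _ => {.recEnd}
  | .one => {.tt}
  | .prod τ₁ τ₂ => (constIdx τ₁ ×ˢ constIdx τ₂).image fun c => .pair c.1 c.2
  | .sum τ₁ τ₂ => (constIdx τ₁).image .inl ∪ (constIdx τ₂).image .inr
  | .arrow _ _ _ _ => {.lam}
  | .mu _ => {.recEnd}
  | .topMu => {.recEnd}

/-- The recursive occurrence index set `ℳ{α.τ}(i)`, where `α` is the variable `0` of `τ`; the type
`τ` is meant to have no other free variable. Under a binder `μβ` the bound variable `β` is replaced
by `⊤_μ`, after which `α` is again the variable `0`. -/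
def occ : Ty → Idx → Finset Idx
  | .var 0, i => {i}
  | .var (_ + 1), _ => ∅
  | .topMu, _ => ∅
  | .one, _ => ∅
  | .sum τ₁ τ₂, i => (occ τ₁ i).image .inl ∪ (occ τ₂ i).image .inr
  | .prod τ₁ τ₂, i =>
      (occ τ₁ i ×ˢ constIdx τ₂).image (fun c => .pair c.1 c.2) ∪
        (constIdx τ₁ ×ˢ occ τ₂ i).image (fun c => .pair c.1 c.2)
  | .arrow _ _ _ _, _ => ∅
  | .mu τ, i => (occ (τ.inst .topMu) i).image .fold
termination_by τ => τ.size
decreasing_by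
  all_goals simp only [Ty.size, Ty.size_inst_topMu]; omega

/-- Base polynomial evaluation `φ_i(v : τ)`, by recursion on the value. It is meaningful for
`v ∈ 𝒱(τ)` and `i ∈ ℐ(τ)`; the last clause gives `0` for mismatched injections, and for ill-typed
arguments. -/
def basePot : Val → Ty → Idx → ℕ
  | .tt, .one, .tt => 1
  | .pair v₁ v₂, .prod τ₁ τ₂, .pair i₁ i₂ => basePot v₁ τ₁ i₁ * basePot v₂ τ₂ i₂
  | .inl v, .sum τ₁ _, .inl i => basePot v τ₁ i
  | .inr v, .sum _ τ₂, .inr i => basePot v τ₂ i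
  | .fn _, .arrow _ _ _ _, .lam => 1
  | .fold v, .mu τ, .fold i =>
      basePot v τ.unfold i + ∑ k ∈ occ τ (.fold i), basePot v τ.unfold k
  | .fold _, .mu _, .recEnd => 1
  | _, _, _ => 0

/-- Annotations `𝒜(τ)`: the free `ℚ≥0`-semimodule on the indices of `τ`. -/
abbrev Annot (τ : Ty) : Type := Indices τ →₀ ℚ≥0

/-- The potential `Φ(v : ⟨τ; P⟩) = ∑ i, p_i * φ_i(v : τ)`. -/
def Annot.potential {τ : Ty} (P : Annot τ) (v : Values τ) : ℚ≥0 :=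
  P.sum fun i p => p * (basePot v.1 τ i.1 : ℚ≥0)

/-! ## The multivariate system for lists and binary trees -/

/-- Data types of the multivariate system. -/
inductive HTy : Type
  | unit
  | bool
  | int
  | prod (A B : HTy)
  | list (A : HTy)
  | tree (A : HTy)

namespace HTy

/-- The set `⟦A⟧` of semantic values of a data type. -/
def Sem : HTy → Type
  | unit => Unit
  | bool => Bool
  | int => ℤ
  | prod A B => Sem A × Sem B
  | list A => List (Sem A)
  | tree A => BinaryTree (Sem A)

/-- The indices: one for each atomic type, pairs for products, and finite sequences of element
indices for both lists and trees. -/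
def Index : HTy → Type
  | unit => Unit
  | bool => Unit
  | int => Unit
  | prod A B => Index A × Index B
  | list A => List (Index A)
  | tree A => List (Index A)

/-- The labels of a binary tree in preorder. -/
def preorder {S : Type} : BinaryTree S → List S
  | .nil => []
  | .node a l r => a :: (preorder l ++ preorder r)

/-- For an index `[i₁, …, i_k]` and a list `[a₁, …, a_n]`, the sum over all
`1 ≤ j₁ < ⋯ < j_k ≤ n` of the products `φ i₁ a_{j₁} ⋯ φ i_k a_{j_k}`. -/
def listPot {I S : Type} (φ : I → S → ℕ) (is : List I) (as : List S) : ℕ :=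
  ∑ j : Fin is.length → Fin as.length with StrictMono j, ∏ m, φ (is.get m) (as.get (j m))

/-- The base polynomial that an index denotes. A tree is evaluated through the list of its labels
in preorder. -/
def basePoly : (A : HTy) → A.Index → A.Sem → ℕ
  | unit, _, _ => 1
  | bool, _, _ => 1
  | int, _, _ => 1
  | prod A B, i, a => basePoly A i.1 a.1 * basePoly B i.2 a.2
  | list A, is, as => listPot (basePoly A) is as
  | tree A, is, t => listPot (basePoly A) is (preorder t)

/-- The resource polynomials of the multivariate system for a data type: the linear combinations
of base polynomials with nonnegative rational coefficients. -/
def resPoly (A : HTy) : Submodule ℚ≥0 (A.Sem → ℚ≥0) :=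
  Submodule.span ℚ≥0 (Set.range fun (i : A.Index) (a : A.Sem) => (A.basePoly i a : ℚ≥0))

end HTy

/-! ## Reading the data types of the multivariate system in the new system -/

namespace Ty

/-- `bool = 1 + 1`. -/
def bool : Ty := .sum .one .one

/-- `list(τ) = μα. 1 + τ × α`. -/
def list (τ : Ty) : Ty := .mu (.sum .one (.prod τ.weaken (.var 0)))

/-- `btree(τ) = μα. 1 + τ × (α × α)`. -/
def btree (τ : Ty) : Ty := .mu (.sum .one (.prod τ.weaken (.prod (.var 0) (.var 0))))

theorem unfold_list (τ : Ty) :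
    unfold (.sum .one (.prod τ.weaken (.var 0))) = .sum .one (.prod τ (list τ)) := by
  have h := inst_weaken τ (list τ)
  simp only [inst] at h
  simp only [unfold, inst, subst, single]
  rw [← list, h]

theorem unfold_btree (τ : Ty) :
    unfold (.sum .one (.prod τ.weaken (.prod (.var 0) (.var 0)))) =
      .sum .one (.prod τ (.prod (btree τ) (btree τ))) := by
  have h := inst_weaken τ (btree τ)
  simp only [inst] at h
  simp only [unfold, inst, subst, single]
  rw [← btree, h]

end Ty

/-- The type of the new system that represents a data type, where the type `ι` represents `int`. -/
def HTy.toTy (ι : Ty) : HTy → Ty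
  | .unit => .one
  | .bool => .bool
  | .int => ι
  | .prod A B => .prod (toTy ι A) (toTy ι B)
  | .list A => .list (toTy ι A)
  | .tree A => .btree (toTy ι A)

namespace Values

/-- `True = inl tt` and `False = inr tt`. -/
def ofBool : Bool → Values .bool
  | true => ⟨.inl .tt, .inl .tt⟩
  | false => ⟨.inr .tt, .inr .tt⟩

def pair {τ₁ τ₂ : Ty} (v₁ : Values τ₁) (v₂ : Values τ₂) : Values (.prod τ₁ τ₂) :=
  ⟨.pair v₁.1 v₂.1, .pair v₁.2 v₂.2⟩

/-- `Nil = fold (inl tt)` and `Cons(h, t) = fold (inr (pair (h; t)))`. -/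
def ofList {S : Type} {τ : Ty} (f : S → Values τ) : List S → Values (.list τ)
  | [] => ⟨.fold (.inl .tt), .fold (by rw [Ty.unfold_list]; exact .inl .tt)⟩
  | a :: as => ⟨.fold (.inr (.pair (f a).1 (ofList f as).1)),
      .fold (by rw [Ty.unfold_list]; exact .inr (.pair (f a).2 (ofList f as).2))⟩

/-- `Leaf = fold (inl tt)` and `Node(a, l, r) = fold (inr (pair (a; pair (l; r))))`. -/
def ofTree {S : Type} {τ : Ty} (f : S → Values τ) : BinaryTree S → Values (.btree τ)
  | .nil => ⟨.fold (.inl .tt), .fold (by rw [Ty.unfold_btree]; exact .inl .tt)⟩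
  | .node a l r => ⟨.fold (.inr (.pair (f a).1 (.pair (ofTree f l).1 (ofTree f r).1))),
      .fold (by
        rw [Ty.unfold_btree]
        exact .inr (.pair (f a).2 (.pair (ofTree f l).2 (ofTree f r).2)))⟩

end Values

/-- The value of the new system that represents a semantic value of a data type, where integers are
represented by values of type `ι` through `encInt`. -/
def HTy.encode {ι : Ty} (encInt : ℤ → Values ι) : (A : HTy) → A.Sem → Values (A.toTy ι)
  | .unit, _ => ⟨.tt, .tt⟩
  | .bool, b => Values.ofBool b
  | .int, n => encInt n
  | .prod A B, a => Values.pair (encode encInt A a.1) (encode encInt B a.2)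
  | .list A, as => Values.ofList (encode encInt A) as
  | .tree A, t => Values.ofTree (encode encInt A) t

end AARA

end

/-! The functions `a ↦ Φ(a° : ⟨A°; P⟩)` form the span `potSpan` of base polynomials, so it suffices
to place each old base polynomial in it. The span contains the constant `1`, because the constant
indices have total potential `1` (`sum_basePot_constIdx`), and it is closed under products on pairs
(`mul_mem_potSpan`).

For a recursive type, the sum over `occ` adds the potential of the same index on each immediate
recursive part. Hence `fold (inr (pair i j))` denotes the sum, over all suffixes `a :: t` of a list,
of `φ_i(a) φ_j(t)`, and likewise over all nodes of a tree. As these sums are linear, they map the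
span of the product type into that of the list or tree type (`suffixSum_mem_potSpan`,
`nodeSum_mem_potSpan`).

By Pascal's rule (`listPot_cons_cons`), the polynomial of `i :: is` on lists is such a suffix sum.
On trees, the preorder `a :: (l ++ r)` splits an index sequence between `l` and `r`. Splits wholly
to one side are absorbed by the node recursion; all others involve shorter sequences only, so strong
induction on the length applies. -/

namespace AARA

/-! ### Substitution calculus and closedness. -/

namespace Ty

theorem liftRen_comp (f g : ℕ → ℕ) :
    (fun n => liftRen g (liftRen f n)) = liftRen (fun n => g (f n)) := by
  funext n
  cases n <;> rfl

theorem rename_rename (τ : Ty) (f g : ℕ → ℕ) :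
    rename g (rename f τ) = rename (fun n => g (f n)) τ := by
  induction τ generalizing f g with
  | mu τ ih => simp [rename, ih, liftRen_comp]
  | _ => simp_all [rename]

theorem rename_liftSub (f : ℕ → ℕ) (s : ℕ → Ty) :
    (fun n => rename (liftRen f) (liftSub s n)) = liftSub (fun n => rename f (s n)) := by
  funext n
  cases n with
  | zero => rfl
  | succ n => simp [liftSub, weaken, rename_rename, liftRen]

theorem rename_subst (τ : Ty) (f : ℕ → ℕ) (s : ℕ → Ty) :
    rename f (subst s τ) = subst (fun n => rename f (s n)) τ := by
  induction τ generalizing f s with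
  | mu τ ih => simp [subst, rename, ih, rename_liftSub]
  | _ => simp_all [subst, rename]

theorem subst_liftSub (s t : ℕ → Ty) :
    (fun n => subst (liftSub t) (liftSub s n)) = liftSub (fun n => subst t (s n)) := by
  funext n
  cases n with
  | zero => rfl
  | succ n => simp [liftSub, weaken, subst_rename, rename_subst]

theorem subst_subst (τ : Ty) (s t : ℕ → Ty) :
    subst t (subst s τ) = subst (fun n => subst t (s n)) τ := by
  induction τ generalizing s t with
  | mu τ ih => simp [subst, ih, subst_liftSub]
  | _ => simp_all [subst]

theorem weaken_eq_subst (τ : Ty) : weaken τ = subst (fun n => var (n + 1)) τ := by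
  rw [← subst_var (weaken τ), weaken, subst_rename]

theorem ClosedAt.rename {τ : Ty} {k m : ℕ} {f : ℕ → ℕ} (h : ClosedAt k τ)
    (hf : ∀ n < k, f n < m) : ClosedAt m (τ.rename f) := by
  induction τ generalizing k m f with
  | mu τ ih =>
    refine ih (k := k + 1) (m := m + 1) h fun n hn => ?_
    cases n with
    | zero => simp [liftRen]
    | succ n => simpa [liftRen] using hf n (by omega)
  | var n => exact hf n h
  | one => trivial
  | topMu => exact h
  | prod _ _ ih₁ ih₂ => exact ⟨ih₁ h.1 hf, ih₂ h.2 hf⟩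
  | sum _ _ ih₁ ih₂ => exact ⟨ih₁ h.1 hf, ih₂ h.2 hf⟩
  | arrow _ _ _ _ ih₁ ih₂ => exact ⟨ih₁ h.1 hf, ih₂ h.2 hf⟩

theorem Closed.list {τ : Ty} (h : τ.Closed) : τ.list.Closed :=
  ⟨trivial, ClosedAt.rename h (by simp), Nat.one_pos⟩

theorem Closed.btree {τ : Ty} (h : τ.Closed) : τ.btree.Closed :=
  ⟨trivial, ClosedAt.rename h (by simp), Nat.one_pos, Nat.one_pos⟩

end Ty

theorem HTy.closed_toTy {ι : Ty} (hι : ι.Closed) (A : HTy) : (A.toTy ι).Closed := by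
  induction A with
  | unit => trivial
  | bool => exact ⟨trivial, trivial⟩
  | int => exact hι
  | prod A B ihA ihB => exact ⟨ihA, ihB⟩
  | list A ih => exact ih.list
  | tree A ih => exact ih.btree

/-! ## Constant indices and recursive occurrences -/

theorem constIdx_rename (τ : Ty) (f : ℕ → ℕ) : constIdx (τ.rename f) = constIdx τ := by
  induction τ generalizing f <;> simp_all [Ty.rename, constIdx]

/-- Closedness excludes variables and `topMu`, which have `end` as constant index but no indices of
their own. -/
theorem hasIdx_of_mem_constIdx {τ : Ty} (h : τ.Closed) {c : Idx} (hc : c ∈ constIdx τ) :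
    HasIdx τ c := by
  induction τ generalizing c with
  | var n => exact absurd h (Nat.not_lt_zero n)
  | topMu => exact h.elim
  | one => obtain rfl : c = .tt := by simpa [constIdx] using hc
           exact .tt
  | arrow => obtain rfl : c = .lam := by simpa [constIdx] using hc
             exact .lam
  | mu => obtain rfl : c = .recEnd := by simpa [constIdx] using hc
          exact .recEnd
  | prod _ _ ih₁ ih₂ =>
    simp only [constIdx, Finset.mem_image, Finset.mem_product] at hc
    obtain ⟨⟨i, j⟩, ⟨hi, hj⟩, rfl⟩ := hc
    exact .pair (ih₁ h.1 hi) (ih₂ h.2 hj)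
  | sum _ _ ih₁ ih₂ =>
    simp only [constIdx, Finset.mem_union, Finset.mem_image] at hc
    obtain ⟨i, hi, rfl⟩ | ⟨i, hi, rfl⟩ := hc
    · exact .inl (ih₁ h.1 hi)
    · exact .inr (ih₂ h.2 hi)

theorem pair_injective : Function.Injective fun c : Idx × Idx => Idx.pair c.1 c.2 := by
  rintro ⟨i, j⟩ ⟨i', j'⟩ h
  simpa using h

theorem inl_injective : Function.Injective Idx.inl := fun _ _ h => Idx.inl.inj h

theorem inr_injective : Function.Injective Idx.inr := fun _ _ h => Idx.inr.inj h

theorem disjoint_inl_inr (s t : Finset Idx) : Disjoint (s.image Idx.inl) (t.image Idx.inr) := by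
  simp [Finset.disjoint_left]

/-- The base polynomials of the constant indices add up to the constant polynomial `1`. -/
theorem sum_basePot_constIdx {τ : Ty} {v : Val} (h : HasVal τ v) :
    ∑ c ∈ constIdx τ, basePot v τ c = 1 := by
  induction h with
  | tt => simp [constIdx, basePot]
  | fn => simp [constIdx, basePot]
  | fold => simp [constIdx, basePot]
  | pair _ _ ih₁ ih₂ =>
    rw [constIdx, Finset.sum_image pair_injective.injOn, Finset.sum_product]
    simp [basePot, ← Finset.mul_sum, ih₁, ih₂]
  | inl _ ih =>
    rw [constIdx, Finset.sum_union (disjoint_inl_inr _ _), Finset.sum_image inl_injective.injOn,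
      Finset.sum_image inr_injective.injOn]
    simp [basePot, ih]
  | inr _ ih =>
    rw [constIdx, Finset.sum_union (disjoint_inl_inr _ _), Finset.sum_image inl_injective.injOn,
      Finset.sum_image inr_injective.injOn]
    simp [basePot, ih]

/-- The substitution removes variable `0`, so nothing is left for `occ` to find. Allowing `topMu` as
an image makes the hypothesis stable under passing a binder. -/
theorem occ_subst_eq_empty (τ : Ty) (s : ℕ → Ty)
    (hs : ∀ n, s n = .topMu ∨ ∃ m, s n = .var (m + 1)) (i : Idx) : occ (τ.subst s) i = ∅ := by
  induction τ generalizing s with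
  | var n =>
    obtain h | ⟨m, h⟩ := hs n <;> simp [Ty.subst, h, occ]
  | mu τ ih =>
    -- Lifting `s` and then instantiating with `topMu` is one substitution: `0 ↦ topMu`, `n + 1 ↦ s
    -- n`.
    rw [Ty.subst, occ, Ty.inst, Ty.subst_subst, ih, Finset.image_empty]
    intro n
    cases n with
    | zero => exact .inl rfl
    | succ n =>
      have h : (Ty.liftSub s (n + 1)).subst (Ty.single .topMu) = s n := Ty.inst_weaken _ _
      rw [h]
      exact hs n
  | _ => simp_all [Ty.subst, occ]

theorem occ_weaken (τ : Ty) (i : Idx) : occ τ.weaken i = ∅ := by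
  rw [Ty.weaken_eq_subst]
  exact occ_subst_eq_empty _ _ (fun n => .inr ⟨n, rfl⟩) i

/-! ### Unfolding the base polynomials of lists and trees. -/

theorem basePot_list_cons {τ : Ty} {v w : Val} (hv : HasVal τ v) (i j : Idx) :
    basePot (.fold (.inr (.pair v w))) τ.list (.fold (.inr (.pair i j))) =
      basePot v τ i * basePot w τ.list j +
        basePot w τ.list (.fold (.inr (.pair i j))) := by
  rw [Ty.list, basePot, Ty.unfold_list]
  simp only [occ, occ_weaken, Finset.image_empty, Finset.empty_product, Finset.empty_union]
  rw [Finset.sum_image inr_injective.injOn, Finset.sum_image pair_injective.injOn,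
    Finset.sum_product]
  simp only [Finset.sum_singleton, basePot, ← Finset.sum_mul, Ty.weaken, constIdx_rename,
    sum_basePot_constIdx hv, one_mul]
  rfl

theorem basePot_list_nil (τ : Ty) (i : Idx) :
    basePot (.fold (.inl .tt)) τ.list (.fold (.inr i)) = 0 := by
  rw [Ty.list, basePot, Ty.unfold_list]
  simp only [occ, occ_weaken, Finset.image_empty, Finset.empty_product, Finset.empty_union]
  rw [Finset.sum_image inr_injective.injOn]
  simp [basePot]

/-- The index recurs once in each subtree. The label then carries the constant indices, which sum to
`1`, and the other subtree carries `end`. -/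
theorem basePot_btree_node {τ : Ty} {v l r : Val} (hv : HasVal τ v) (hl : HasVal τ.btree l)
    (hr : HasVal τ.btree r) (i j k : Idx) :
    basePot (.fold (.inr (.pair v (.pair l r)))) τ.btree (.fold (.inr (.pair i (.pair j k)))) =
      basePot v τ i * (basePot l τ.btree j * basePot r τ.btree k) +
        (basePot l τ.btree (.fold (.inr (.pair i (.pair j k)))) +
          basePot r τ.btree (.fold (.inr (.pair i (.pair j k))))) := by
  have hend : ∀ {u}, HasVal τ.btree u → basePot u τ.btree .recEnd = 1 := by
    rintro _ ⟨⟩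
    rfl
  rw [Ty.btree, basePot, Ty.unfold_btree]
  simp only [occ, occ_weaken, constIdx, Finset.image_empty, Finset.empty_product,
    Finset.empty_union]
  rw [Finset.sum_image inr_injective.injOn, Finset.sum_image pair_injective.injOn,
    Finset.sum_product]
  simp only [basePot, ← Finset.mul_sum, ← Finset.sum_mul, Ty.weaken, constIdx_rename,
    sum_basePot_constIdx hv, one_mul]
  congr 1
  -- Left and right occurrences are disjoint because a `fold` index is never `end`.
  rw [Finset.sum_union (by simp), Finset.sum_image pair_injective.injOn,
    Finset.sum_image pair_injective.injOn]
  simp [basePot, hend hl, hend hr]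
  rfl

theorem basePot_btree_nil (τ : Ty) (i : Idx) :
    basePot (.fold (.inl .tt)) τ.btree (.fold (.inr i)) = 0 := by
  rw [Ty.btree, basePot, Ty.unfold_btree]
  simp only [occ, occ_weaken, Finset.image_empty, Finset.empty_product, Finset.empty_union]
  rw [Finset.sum_image inr_injective.injOn]
  simp [basePot]

/-! ## The span of the base polynomials of a type -/

/-- The functions `s ↦ Φ(f s : ⟨τ; P⟩)` for annotations `P` of `τ`. -/
def potSpan {S : Type} {τ : Ty} (f : S → Values τ) : Submodule ℚ≥0 (S → ℚ≥0) :=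
  Submodule.span ℚ≥0 (Set.range fun (i : Indices τ) s => (basePot (f s).1 τ i.1 : ℚ≥0))

theorem basePot_mem_potSpan {S : Type} {τ : Ty} (f : S → Values τ) {i : Idx} (hi : HasIdx τ i) :
    (fun s => (basePot (f s).1 τ i : ℚ≥0)) ∈ potSpan f :=
  Submodule.subset_span ⟨⟨i, hi⟩, rfl⟩

theorem exists_annot_of_mem_potSpan {S : Type} {τ : Ty} {f : S → Values τ} {p : S → ℚ≥0}
    (hp : p ∈ potSpan f) : ∃ P : Annot τ, ∀ s, P.potential (f s) = p s := by
  obtain ⟨P, rfl⟩ := Finsupp.mem_span_range_iff_exists_finsupp.1 hp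
  refine ⟨P, fun s => ?_⟩
  simp [Annot.potential, Finsupp.sum, Finset.sum_apply]

theorem one_mem_potSpan {S : Type} {τ : Ty} (hτ : τ.Closed) (f : S → Values τ) :
    (fun _ => 1) ∈ potSpan f := by
  have h : (fun _ => 1 : S → ℚ≥0) =
      ∑ c ∈ constIdx τ, fun s => (basePot (f s).1 τ c : ℚ≥0) := by
    funext s
    rw [Finset.sum_apply, ← Nat.cast_sum, sum_basePot_constIdx (f s).2, Nat.cast_one]
  rw [h]
  exact Submodule.sum_mem _ fun c hc => basePot_mem_potSpan f (hasIdx_of_mem_constIdx hτ hc)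

/-- By bilinearity it is enough to treat generators, where `pair i j` is the required index. -/
theorem mul_mem_potSpan {S T : Type} {σ τ : Ty} {f : S → Values σ} {g : T → Values τ}
    {p : S → ℚ≥0} {q : T → ℚ≥0} (hp : p ∈ potSpan f) (hq : q ∈ potSpan g) :
    (fun x : S × T => p x.1 * q x.2) ∈ potSpan fun x : S × T => Values.pair (f x.1) (g x.2) := by
  induction hp, hq using Submodule.span_induction₂ with
  | mem_mem _ _ hp hq =>
    obtain ⟨i, rfl⟩ := hp
    obtain ⟨j, rfl⟩ := hq
    have h := basePot_mem_potSpan (fun x : S × T => Values.pair (f x.1) (g x.2))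
      (HasIdx.pair i.2 j.2)
    simpa [Values.pair, basePot] using h
  | zero_left =>
    refine Set.mem_of_eq_of_mem ?_ (potSpan _).zero_mem
    funext x
    simp
  | zero_right =>
    refine Set.mem_of_eq_of_mem ?_ (potSpan _).zero_mem
    funext x
    simp
  | add_left _ _ _ _ _ _ h₁ h₂ =>
    refine Set.mem_of_eq_of_mem ?_ (Submodule.add_mem _ h₁ h₂)
    funext x
    simp [add_mul]
  | add_right _ _ _ _ _ _ h₁ h₂ =>
    refine Set.mem_of_eq_of_mem ?_ (Submodule.add_mem _ h₁ h₂)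
    funext x
    simp [mul_add]
  | smul_left r _ _ _ _ h =>
    refine Set.mem_of_eq_of_mem ?_ (Submodule.smul_mem _ r h)
    funext x
    simp [mul_assoc]
  | smul_right r _ _ _ _ h =>
    refine Set.mem_of_eq_of_mem ?_ (Submodule.smul_mem _ r h)
    funext x
    simp [mul_left_comm]

/-- The sum of `F (a, t)` over all suffixes `a :: t` of a list. -/
def suffixSum {S : Type} (F : S × List S → ℚ≥0) : List S → ℚ≥0
  | [] => 0
  | a :: as => F (a, as) + suffixSum F as

def suffixSumHom (S : Type) : (S × List S → ℚ≥0) →ₗ[ℚ≥0] List S → ℚ≥0 where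
  toFun := suffixSum
  map_add' F G := by
    funext as
    induction as with
    | nil => simp [suffixSum]
    | cons a as ih => simp only [suffixSum, ih, Pi.add_apply]; ring
  map_smul' r F := by
    funext as
    induction as with
    | nil => simp [suffixSum]
    | cons a as ih => simp [suffixSum, ih, mul_add]

/-- The sum of `F (a, l, r)` over all nodes of a tree, with label `a` and subtrees `l` and `r`. -/
def nodeSum {S : Type} (F : S × BinaryTree S × BinaryTree S → ℚ≥0) : BinaryTree S → ℚ≥0
  | .nil => 0
  | .node a l r => F (a, l, r) + (nodeSum F l + nodeSum F r)

def nodeSumHom (S : Type) :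
    (S × BinaryTree S × BinaryTree S → ℚ≥0) →ₗ[ℚ≥0] BinaryTree S → ℚ≥0 where
  toFun := nodeSum
  map_add' F G := by
    funext t
    induction t with
    | nil => simp [nodeSum]
    | node a l r ihl ihr => simp only [nodeSum, ihl, ihr, Pi.add_apply]; ring
  map_smul' r F := by
    funext t
    induction t with
    | nil => simp [nodeSum]
    | node a l r ihl ihr => simp [nodeSum, ihl, ihr, mul_add]

/-- By linearity `F` may be the base polynomial of `pair i j`; its suffix sum satisfies the
recursion of `fold (inr (pair i j))`. -/
theorem suffixSum_mem_potSpan {S : Type} {τ : Ty} {f : S → Values τ} {F : S × List S → ℚ≥0}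
    (hF : F ∈ potSpan fun x : S × List S => Values.pair (f x.1) (Values.ofList f x.2)) :
    suffixSum F ∈ potSpan (Values.ofList f) := by
  refine Submodule.span_le (p := (potSpan (Values.ofList f)).comap (suffixSumHom S)).2 ?_ hF
  rintro _ ⟨⟨_, hi⟩, rfl⟩
  obtain - | @⟨_, _, i, j, hi, hj⟩ := hi
  have hij : HasIdx τ.list (.fold (.inr (.pair i j))) :=
    .fold (by rw [Ty.unfold_list]; exact .inr (.pair hi hj))
  rw [SetLike.mem_coe, Submodule.mem_comap]
  refine Set.mem_of_eq_of_mem ?_ (basePot_mem_potSpan (Values.ofList f) hij)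
  funext as
  induction as with
  | nil => simp [suffixSumHom, suffixSum, Values.ofList, basePot_list_nil]
  | cons a as ih =>
    simp only [suffixSumHom, LinearMap.coe_mk, AddHom.coe_mk] at ih ⊢
    rw [suffixSum, ih]
    simp [Values.ofList, Values.pair, basePot_list_cons (f a).2, basePot]

theorem nodeSum_mem_potSpan {S : Type} {τ : Ty} {f : S → Values τ}
    {F : S × BinaryTree S × BinaryTree S → ℚ≥0}
    (hF : F ∈ potSpan fun x : S × BinaryTree S × BinaryTree S =>
      Values.pair (f x.1) (Values.pair (Values.ofTree f x.2.1) (Values.ofTree f x.2.2))) :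
    nodeSum F ∈ potSpan (Values.ofTree f) := by
  refine Submodule.span_le (p := (potSpan (Values.ofTree f)).comap (nodeSumHom S)).2 ?_ hF
  rintro _ ⟨⟨_, hi⟩, rfl⟩
  obtain - | @⟨_, _, i, _, hi, hjk⟩ := hi
  obtain - | @⟨_, _, j, k, hj, hk⟩ := hjk
  have hijk : HasIdx τ.btree (.fold (.inr (.pair i (.pair j k)))) :=
    .fold (by rw [Ty.unfold_btree]; exact .inr (.pair hi (.pair hj hk)))
  rw [SetLike.mem_coe, Submodule.mem_comap]
  refine Set.mem_of_eq_of_mem ?_ (basePot_mem_potSpan (Values.ofTree f) hijk)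
  funext t
  induction t with
  | nil => simp [nodeSumHom, nodeSum, Values.ofTree, basePot_btree_nil]
  | node a l r ihl ihr =>
    simp only [nodeSumHom, LinearMap.coe_mk, AddHom.coe_mk] at ihl ihr ⊢
    rw [nodeSum, ihl, ihr]
    simp [Values.ofTree, Values.pair,
      basePot_btree_node (f a).2 (Values.ofTree f l).2 (Values.ofTree f r).2, basePot]

/-! ## Recursion for the base polynomials of lists -/

namespace HTy

variable {I S : Type} (φ : I → S → ℕ)

theorem listPot_nil_left (as : List S) : listPot φ [] as = 1 := by
  have h : (Finset.univ.filter fun j : Fin 0 → Fin as.length => StrictMono j) = Finset.univ :=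
    Finset.filter_true_of_mem fun j _ => Subsingleton.strictMono j
  exact (Finset.sum_congr h fun _ _ => rfl).trans (by simp)

theorem listPot_cons_nil (i : I) (is : List I) : listPot φ (i :: is) [] = 0 := by
  refine Finset.sum_eq_zero fun j _ => ?_
  exact (j ⟨0, by simp⟩).elim0

theorem strictMono_cons_zero {k n : ℕ} {j : Fin k → Fin n} (hj : StrictMono j) :
    StrictMono (Fin.cons 0 fun m => (j m).succ : Fin (k + 1) → Fin (n + 1)) := by
  intro a b hab
  induction b using Fin.cases with
  | zero => exact absurd hab (Fin.not_lt_zero a)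
  | succ b =>
    induction a using Fin.cases with
    | zero => simp
    | succ a => simpa using hj (Fin.succ_lt_succ_iff.1 hab)

theorem ne_zero_of_strictMono {k n : ℕ} {j : Fin (k + 1) → Fin (n + 1)} (hj : StrictMono j)
    (h0 : j 0 ≠ 0) (m : Fin (k + 1)) : j m ≠ 0 :=
  ((Fin.pos_iff_ne_zero.2 h0).trans_le (hj.monotone (Fin.zero_le m))).ne'

/-- Split on whether position `0` is selected. If so, it is the value at `0` and the later values
are successors; if not, all values are. -/
theorem sum_strictMono_succ {k n : ℕ} (w : (Fin (k + 1) → Fin (n + 1)) → ℕ) :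
    ∑ j with StrictMono j, w j =
      ∑ j : Fin k → Fin n with StrictMono j, w (Fin.cons 0 fun m => (j m).succ) +
        ∑ j : Fin (k + 1) → Fin n with StrictMono j, w fun m => (j m).succ := by
  rw [← Finset.sum_filter_add_sum_filter_not _ fun j : Fin (k + 1) → Fin (n + 1) => j 0 = 0]
  congr 1 <;> symm
  · refine Finset.sum_nbij (fun j => Fin.cons 0 fun m => (j m).succ) ?_ ?_ ?_ fun _ _ => rfl
    · intro j hj
      simp only [Finset.mem_filter, Finset.mem_univ, true_and] at hj ⊢
      exact ⟨strictMono_cons_zero hj, rfl⟩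
    · intro j _ j' _ h
      funext m
      simpa using congrFun h m.succ
    · intro j hj
      simp only [Finset.coe_filter, Finset.mem_filter, Finset.mem_univ, true_and,
        Set.mem_ofPred_eq] at hj
      obtain ⟨hj, h0⟩ := hj
      have hne : ∀ m : Fin k, j m.succ ≠ 0 := fun m h =>
        absurd (hj (Fin.succ_pos m)) (by simp [h])
      refine ⟨fun m => (j m.succ).pred (hne m), ?_, ?_⟩
      · simp only [Finset.coe_filter, Finset.mem_univ, true_and, Set.mem_ofPred_eq]
        intro a b hab
        exact Fin.pred_lt_pred_iff.2 (hj (Fin.succ_lt_succ_iff.2 hab))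
      · funext m
        induction m using Fin.cases <;> simp [h0]
  · refine Finset.sum_nbij (fun j m => (j m).succ) ?_ ?_ ?_ fun _ _ => rfl
    · intro j hj
      simp only [Finset.mem_filter, Finset.mem_univ, true_and] at hj ⊢
      exact ⟨fun a b hab => Fin.succ_lt_succ_iff.2 (hj hab), Fin.succ_ne_zero _⟩
    · intro j _ j' _ h
      funext m
      simpa using congrFun h m
    · intro j hj
      simp only [Finset.coe_filter, Finset.mem_filter, Finset.mem_univ, true_and,
        Set.mem_ofPred_eq] at hj
      obtain ⟨hj, h0⟩ := hj
      refine ⟨fun m => (j m).pred (ne_zero_of_strictMono hj h0 m), ?_, ?_⟩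
      · simp only [Finset.coe_filter, Finset.mem_univ, true_and, Set.mem_ofPred_eq]
        intro a b hab
        exact Fin.pred_lt_pred_iff.2 (hj hab)
      · funext m
        simp

theorem listPot_cons_cons (i : I) (is : List I) (a : S) (as : List S) :
    listPot φ (i :: is) (a :: as) = φ i a * listPot φ is as + listPot φ (i :: is) as := by
  refine (sum_strictMono_succ (k := is.length) (n := as.length) fun j =>
    ∏ m, φ ((i :: is).get m) ((a :: as).get (j m))).trans ?_
  rw [listPot, Finset.mul_sum]
  congr 1
  refine Finset.sum_congr rfl fun j _ => ?_
  refine (Fin.prod_univ_succ (n := is.length) _).trans ?_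
  simp

/-- The selected positions of a concatenation split into those in either part. -/
theorem listPot_append (is : List I) (as bs : List S) :
    listPot φ is (as ++ bs) =
      ∑ m ∈ Finset.range (is.length + 1),
        listPot φ (is.take m) as * listPot φ (is.drop m) bs := by
  induction as generalizing is with
  | nil =>
    -- Only `m = 0` survives: a nonempty prefix selects nothing from the empty list.
    rw [Finset.sum_range_succ', Finset.sum_eq_zero]
    · simp [listPot_nil_left]
    · intro m hm
      obtain - | ⟨i, is⟩ := is
      · simp at hm
      · simp [listPot_cons_nil]
  | cons a as ih =>
    obtain - | ⟨i, is⟩ := is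
    · simp [listPot_nil_left]
    · rw [List.cons_append, listPot_cons_cons, ih, ih, List.length_cons,
        Finset.sum_range_succ' _ (is.length + 1), Finset.sum_range_succ' _ (is.length + 1)]
      simp only [List.take_succ_cons, List.drop_succ_cons, listPot_cons_cons, add_mul,
        Finset.sum_add_distrib, Finset.mul_sum, List.take_zero, listPot_nil_left, mul_assoc]
      ring

/-- Isolates the two one-sided splits, so that both factors of each remaining term have index
sequences shorter than `i :: is`. -/
theorem listPot_cons_append (i : I) (is : List I) (as bs : List S) :
    listPot φ (i :: is) (as ++ bs) =
      listPot φ (i :: is) as + listPot φ (i :: is) bs +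
        ∑ m ∈ Finset.range is.length,
          listPot φ (i :: is.take m) as * listPot φ (is.drop m) bs := by
  rw [listPot_append, List.length_cons, Finset.sum_range_succ', Finset.sum_range_succ]
  simp [listPot_nil_left]
  ring

end HTy

/-! ## Resource polynomials of the multivariate system -/

open HTy

/-- The empty sequence is the index `end`; Pascal's rule is the recursion of a suffix sum. -/
theorem listPot_mem_potSpan {I S : Type} {τ : Ty} {f : S → Values τ} {φ : I → S → ℕ}
    (hφ : ∀ i, (fun a => (φ i a : ℚ≥0)) ∈ potSpan f) (is : List I) :
    (fun as => (listPot φ is as : ℚ≥0)) ∈ potSpan (Values.ofList f) := by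
  induction is with
  | nil =>
    refine Set.mem_of_eq_of_mem ?_ (basePot_mem_potSpan (Values.ofList f) .recEnd)
    funext as
    cases as <;> simp [listPot_nil_left, Values.ofList, Ty.list, basePot]
  | cons i is ih =>
    refine Set.mem_of_eq_of_mem ?_ (suffixSum_mem_potSpan (mul_mem_potSpan (hφ i) ih))
    funext as
    induction as with
    | nil => simp [listPot_cons_nil, suffixSum]
    | cons a as ih => simp [listPot_cons_cons, suffixSum, ← ih]

theorem listPot_preorder_mem_potSpan {I S : Type} {τ : Ty} (hτ : τ.Closed) {f : S → Values τ}
    {φ : I → S → ℕ} (hφ : ∀ i, (fun a => (φ i a : ℚ≥0)) ∈ potSpan f) (is : List I) :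
    (fun t => (listPot φ is (preorder t) : ℚ≥0)) ∈ potSpan (Values.ofTree f) := by
  induction hn : is.length using Nat.strong_induction_on generalizing is with
  | _ n ih =>
    subst hn
    obtain - | ⟨i, is⟩ := is
    · simpa [listPot_nil_left] using one_mem_potSpan hτ.btree (Values.ofTree f)
    have hlt {js : List I} (h : js.length ≤ is.length) :=
      ih js.length (by simpa using Nat.lt_succ_of_le h) js rfl
    -- The node label is selected for `i`, and `is` is split between the subtrees in any way.
    have h₁ := Submodule.sum_mem _ fun m (_ : m ∈ Finset.range (is.length + 1)) =>
      mul_mem_potSpan (hφ i) (mul_mem_potSpan (hlt (js := is.take m) (by simp))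
        (hlt (js := is.drop m) (by simp)))
    -- The label is not selected, hence the factor `1`, and both subtrees receive part of `i :: is`.
    have h₂ := Submodule.sum_mem _ fun m (hm : m ∈ Finset.range is.length) =>
      mul_mem_potSpan (one_mem_potSpan hτ f)
        (mul_mem_potSpan (hlt (js := i :: is.take m) (by simpa using hm))
        (hlt (js := is.drop m) (by simp)))
    refine Set.mem_of_eq_of_mem ?_ (nodeSum_mem_potSpan (Submodule.add_mem _ h₁ h₂))
    funext t
    induction t with
    | nil => simp [preorder, listPot_cons_nil, nodeSum]
    | node a l r ihl ihr =>
      simp only [nodeSum, ← ihl, ← ihr, preorder]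
      rw [listPot_cons_cons, listPot_append, listPot_cons_append]
      simp [Finset.sum_apply, Finset.mul_sum]
      ring

/-- Atomic types need only the constant `1`, so any encoding of integers will do. -/
theorem basePoly_mem_potSpan {ι : Ty} (hι : ι.Closed) (encInt : ℤ → Values ι) (A : HTy)
    (i : A.Index) : (fun a => (A.basePoly i a : ℚ≥0)) ∈ potSpan (A.encode encInt) := by
  induction A with
  | unit => simpa [basePoly] using one_mem_potSpan (closed_toTy hι .unit) (encode encInt .unit)
  | bool => simpa [basePoly] using one_mem_potSpan (closed_toTy hι .bool) (encode encInt .bool)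
  | int => simpa [basePoly] using one_mem_potSpan (closed_toTy hι .int) (encode encInt .int)
  | prod A B ihA ihB =>
    refine Set.mem_of_eq_of_mem ?_ (mul_mem_potSpan (ihA i.1) (ihB i.2))
    funext a
    exact Nat.cast_mul _ _
  | list A ih => exact listPot_mem_potSpan ih i
  | tree A ih => exact listPot_preorder_mem_potSpan (closed_toTy hι A) ih i

end AARA

theorem mainTheorem4 (ι : AARA.Ty) (hι : ι.Closed) (encInt : ℤ → AARA.Values ι)
    (A : AARA.HTy) (p : A.Sem → ℚ≥0) (hp : p ∈ A.resPoly) :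
    ∃ P : AARA.Annot (A.toTy ι), ∀ a : A.Sem, P.potential (A.encode encInt a) = p a := by
  refine AARA.exists_annot_of_mem_potSpan (Submodule.span_le.2 ?_ hp)
  rintro _ ⟨i, rfl⟩
  exact AARA.basePoly_mem_potSpan hι encInt A i
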